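/- Let $G$ be a countable group which contains a nonabelian free subgroup, let $H$ be a nontrivial cyclic group, and let $G*H$ be their free product. A *countable Borel quasi-order* is a reflexive and transitive relation $Q$ on a standard Borel space $X$ such that $Q$ is a Borel subset of $X^2$ and $\{y : y\,Q\,x\}$ is countable for every $x\in X$. It is *universal* if for every countable Borel quasi-order $R$ on a standard Borel space $Y$ there is a Borel map $f:Y\to X$ with $x\,R\,y \Leftrightarrow f(x)\,Q\,f(y)$ for all $x,y\in Y$. Let $\mathrm{Sg}(G*H)$ be the space of subgroups of $G*H$, with the Borel structure inherited from the power set $2^{G*H}$, and let $\Gamma(G*H)\subseteq \mathrm{Sg}(G*H)$ be the subspace of infinite subgroups. For $A,B\in\mathrm{Sg}(G*H)$ write $$A\preccurlyeq_c B \iff \text{there are } n\ge 1 \text{ and } g_1,\dots,g_n\in G*H \text{ with } A=g_1Bg_1^{-1}\cap\dots\cap g_nBg_n^{-1}.$$ Then the restriction of $\preccurlyeq_c$ to $\Gamma(G*H)$ is a universal countable Borel quasi-order, and $\preccurlyeq_c$ on all of $\mathrm{Sg}(G*H)$ is a universal countable Borel quasi-order. -/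

import Mathlib

/-- `Q` is a countable Borel quasi-order on the standard Borel space `X`: a reflexive transitive
relation, Borel as a subset of `X × X`, all of whose sets of predecessors are countable. -/
structure IsCountableBorelQuasiOrder {X : Type*} [MeasurableSpace X] (Q : X → X → Prop) :
    Prop where
  standardBorel : StandardBorelSpace X
  refl : ∀ x, Q x x
  trans : ∀ x y z, Q x y → Q y z → Q x z
  borel : MeasurableSet {p : X × X | Q p.1 p.2}
  countable_predecessors : ∀ x, {y | Q y x}.Countable

/-- `Q ≤_B Q'`: there is a Borel map `f` with `x Q y ↔ f x Q' f y`. -/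
def BorelReducible {X Y : Type*} [MeasurableSpace X] [MeasurableSpace Y]
    (Q : X → X → Prop) (Q' : Y → Y → Prop) : Prop :=
  ∃ f : X → Y, Measurable f ∧ ∀ x y, Q x y ↔ Q' (f x) (f y)

/-- `Q'` is a universal countable Borel quasi-order: it is a countable Borel quasi-order to which
every countable Borel quasi-order (on a standard Borel space in an arbitrary universe `w`)
is Borel reducible. -/
def IsUniversalCountableBorelQuasiOrder.{w, u} {Y : Type u} [MeasurableSpace Y]
    (Q' : Y → Y → Prop) : Prop :=
  IsCountableBorelQuasiOrder Q' ∧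
    ∀ (X : Type w) [MeasurableSpace X] (Q : X → X → Prop),
      IsCountableBorelQuasiOrder Q → BorelReducible Q Q'

/-- The Borel structure on the space of subgroups of `G`, inherited from the power set of `G`,
i.e. from the product `G → Prop`. -/
instance Subgroup.instMeasurableSpaceOfSet {G : Type*} [Group G] :
    MeasurableSpace (Subgroup G) :=
  MeasurableSpace.comap (fun A : Subgroup G => (A : Set G)) inferInstance

/-- `A ≼_c B`: `A` is the intersection of finitely many (and at least one) conjugates
`g B g⁻¹` of `B`. -/
def ConjIntersection {G : Type*} [Group G] (A B : Subgroup G) : Prop :=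
  ∃ (n : ℕ) (g : Fin (n + 1) → G), A = ⨅ i, B.map (MulAut.conj (g i)).toMonoidHom

/-- The space of infinite subgroups of `G`, with the Borel structure of a subspace. -/
abbrev InfiniteSubgroup (G : Type*) [Group G] : Type _ :=
  {A : Subgroup G // (A : Set G).Infinite}

/-- The restriction of `≼_c` to the space of infinite subgroups. -/
def ConjIntersectionInfinite {G : Type*} [Group G] (A B : InfiniteSubgroup G) : Prop :=
  ConjIntersection A.1 B.1

universe u v w

/-! Let `Q` be a countable Borel quasi-order on `X`. By Lusin–Novikov there are Borel maps `F n`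
such that the predecessors of `x` are exactly the points `F n x`; fix also a Borel injection `β` of
`X` into Cantor space.

Attach to `x` the set of positive words that name a composition of maps `F n` and then a correct
coordinate of `β` at the resulting point. This subset of a free group of infinite rank, hence of
`G`, behaves well under left translation. The code of `F n x` is the intersection of two translates
of the code of `x`, one for each of the two letters naming `F n` (`mem_orbitCode_map_iff`).
Conversely, if a translate of the code of `y` lies in the code of `x`, the translating element must
be a positive word, and the maps it names lead from `x` to `y` (`rel_of_orbitCode_subset`).

Subsets become subgroups by sending `A ⊆ G` to the subgroup of `G ∗ H` generated by the conjugates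
`a H a⁻¹`, `a ∈ A`. All these conjugates together generate their free product, on which `G` acts by
permuting factors. Hence translates become conjugates, intersections are preserved, and an inclusion
in a conjugate forces an inclusion in a translate (`exists_translate_of_conj_mem_conjSubgroup`). The
codes are infinite, so the same map serves both claims.

Lusin–Novikov is proved by a splitting argument: if countably many Borel sets of injectivity do not
suffice, some fibre contains a nonempty perfect set. -/

/-! ### The Lusin–Novikov uniformization theorem -/

section LusinNovikov

open Set Filter Topology MeasureTheory

/-- `C` is a countable union of Borel sets on each of which `f` is injective. -/
def CountablyInjOn {Z X : Type*} [MeasurableSpace Z] (f : Z → X) (C : Set Z) : Prop :=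
  ∃ D : ℕ → Set Z, (∀ n, MeasurableSet (D n)) ∧ (∀ n, InjOn f (D n)) ∧ C = ⋃ n, D n

namespace CountablyInjOn

variable {Z X : Type*} [MeasurableSpace Z] {f : Z → X}

theorem measurableSet {C : Set Z} (h : CountablyInjOn f C) : MeasurableSet C := by
  obtain ⟨D, hD, -, rfl⟩ := h
  exact .iUnion hD

theorem of_injOn {C : Set Z} (hC : MeasurableSet C) (h : InjOn f C) : CountablyInjOn f C :=
  ⟨fun _ => C, fun _ => hC, fun _ => h, (iUnion_const C).symm⟩

theorem empty : CountablyInjOn f ∅ := of_injOn .empty (injOn_empty f)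

theorem iUnion {ι : Type*} [Countable ι] {C : ι → Set Z} (h : ∀ i, CountablyInjOn f (C i)) :
    CountablyInjOn f (⋃ i, C i) := by
  cases isEmpty_or_nonempty ι
  · simpa using empty
  choose D hD hi hu using h
  obtain ⟨e, he⟩ := exists_surjective_nat (ι × ℕ)
  refine ⟨fun n => D (e n).1 (e n).2, fun n => hD _ _, fun n => hi _ _, ?_⟩
  rw [he.iUnion_comp (fun p : ι × ℕ => D p.1 p.2), iUnion_prod']
  exact iUnion_congr hu

theorem union {C C' : Set Z} (h : CountablyInjOn f C) (h' : CountablyInjOn f C') :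
    CountablyInjOn f (C ∪ C') := by
  rw [union_eq_iUnion]
  exact iUnion (Bool.rec h' h)

end CountablyInjOn

/-- Countably many Borel sets on which `f` is injective cover, for every common value `x` of `f` on
`A 0, …, A (k - 1)`, the fibre over `x` in one of these sets. -/
def FiberThin {Z X : Type*} [MeasurableSpace Z] (f : Z → X) (k : ℕ) (A : ℕ → Set Z) : Prop :=
  ∃ C, CountablyInjOn f C ∧
    ∀ x, (∀ i < k, ∃ z ∈ A i, f z = x) → ∃ i < k, ∀ z ∈ A i, f z = x → z ∈ C

/-- Replace `A i` by `A i ∩ U` and append `A i ∩ V` at position `k`. -/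
def splitAt {Z : Type*} (A : ℕ → Set Z) (i k : ℕ) (U V : Set Z) : ℕ → Set Z :=
  Function.update (Function.update A i (A i ∩ U)) k (A i ∩ V)

theorem splitAt_left {Z : Type*} (A : ℕ → Set Z) {i k : ℕ} (h : i < k) (U V : Set Z) :
    splitAt A i k U V i = A i ∩ U := by
  simp [splitAt, h.ne]

theorem splitAt_right {Z : Type*} (A : ℕ → Set Z) (i k : ℕ) (U V : Set Z) :
    splitAt A i k U V k = A i ∩ V := by
  simp [splitAt]

theorem splitAt_of_ne {Z : Type*} (A : ℕ → Set Z) {i k j : ℕ} (hi : j ≠ i) (hk : j ≠ k)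
    (U V : Set Z) : splitAt A i k U V j = A j := by
  simp [splitAt, hi, hk]

theorem MeasureTheory.AnalyticSet.inter_analyticSet {X : Type*} [TopologicalSpace X] [T2Space X]
    {s t : Set X} (hs : AnalyticSet s) (ht : AnalyticSet t) : AnalyticSet (s ∩ t) := by
  rw [inter_eq_iInter]
  exact AnalyticSet.iInter (Bool.rec ht hs)

section Polish

variable {Z X : Type*} [TopologicalSpace Z] [PolishSpace Z] [MeasurableSpace Z] [BorelSpace Z]
  [TopologicalSpace X] [PolishSpace X] [MeasurableSpace X] [BorelSpace X] {f : Z → X}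

/-- An analytic set on which `f` is injective is contained in a Borel set on which `f` is
injective. -/
theorem exists_measurableSet_injOn_superset (hf : Continuous f) {ι : Type*} [Countable ι]
    {U : ι → Set Z} (hU : ∀ i, MeasurableSet (U i))
    (hsep : ∀ z z', z ≠ z' → ∃ i j, Disjoint (U i) (U j) ∧ z ∈ U i ∧ z' ∈ U j)
    {A : Set Z} (hA : AnalyticSet A) (hinj : InjOn f A) :
    ∃ B, A ⊆ B ∧ MeasurableSet B ∧ InjOn f B := by
  -- Injectivity of `f` on `A` makes the images of disjoint pieces of `A` disjoint analytic sets, so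
  -- Lusin separation applies.
  have key : ∀ p : {p : ι × ι // Disjoint (U p.1) (U p.2)}, ∃ D : Set X,
      f '' (A ∩ U p.1.1) ⊆ D ∧ Disjoint (f '' (A ∩ U p.1.2)) D ∧ MeasurableSet D := by
    intro p
    refine AnalyticSet.measurablySeparable ?_ ?_ ?_
    · exact (hA.inter_analyticSet (hU _).analyticSet).image_of_continuous hf
    · exact (hA.inter_analyticSet (hU _).analyticSet).image_of_continuous hf
    · rw [Set.disjoint_left]
      rintro _ ⟨z, ⟨hz, hzU⟩, rfl⟩ ⟨z', ⟨hz', hzU'⟩, h⟩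
      cases hinj hz' hz h
      exact (Set.disjoint_left.1 p.2) hzU hzU'
  choose D hD hD' hDm using key
  refine ⟨⋂ p : {p : ι × ι // Disjoint (U p.1) (U p.2)},
    ((U p.1.1)ᶜ ∪ f ⁻¹' D p) ∩ ((U p.1.2)ᶜ ∪ f ⁻¹' (D p)ᶜ), ?_, ?_, ?_⟩
  · intro z hz
    refine mem_iInter.2 fun p => ⟨?_, ?_⟩
    · by_cases h : z ∈ U p.1.1
      · exact .inr (hD p ⟨z, ⟨hz, h⟩, rfl⟩)
      · exact .inl h
    · by_cases h : z ∈ U p.1.2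
      · exact .inr (Set.disjoint_left.1 (hD' p) ⟨z, ⟨hz, h⟩, rfl⟩)
      · exact .inl h
  · exact .iInter fun p => (((hU _).compl).union (hf.measurable (hDm p))).inter
      (((hU _).compl).union (hf.measurable (hDm p).compl))
  · intro z hz z' hz' h
    by_contra hne
    obtain ⟨i, j, hij, hi, hj⟩ := hsep z z' hne
    have h1 := (mem_iInter.1 hz ⟨(i, j), hij⟩).1.resolve_left (fun h => h hi)
    have h2 := (mem_iInter.1 hz' ⟨(i, j), hij⟩).2.resolve_left (fun h => h hj)
    exact h2 (h ▸ h1 : f z' ∈ _)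

/-- Remove the union `E` of the covers of all splittings. Two remaining points of `A i` with one
common value, attained on every `A j \ E`, would be separated by some disjoint `U a`, `U b` and
contradict thinness of that splitting. So `f` is injective on the analytic remainder `R`, and a
Borel set of injectivity containing `R` completes the cover. -/
theorem FiberThin.of_splitAt (hf : Continuous f) {ι : Type*} [Countable ι]
    {U : ι → Set Z} (hU : ∀ i, MeasurableSet (U i))
    (hsep : ∀ z z', z ≠ z' → ∃ i j, Disjoint (U i) (U j) ∧ z ∈ U i ∧ z' ∈ U j)
    {k i : ℕ} (hi : i < k) {A : ℕ → Set Z} (hA : ∀ j, MeasurableSet (A j))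
    (h : ∀ a b, Disjoint (U a) (U b) → FiberThin f (k + 1) (splitAt A i k (U a) (U b))) :
    FiberThin f k A := by
  choose C hC hcov using fun p : {p : ι × ι // Disjoint (U p.1) (U p.2)} => h p.1.1 p.1.2 p.2
  have hCu := CountablyInjOn.iUnion hC
  have hCm := hCu.measurableSet
  set E := ⋃ p, C p with hE
  set R : Set Z := (A i \ E) ∩ f ⁻¹' (⋂ j : Fin k, f '' (A j \ E)) with hR
  have : Nonempty (Fin k) := ⟨⟨i, hi⟩⟩
  have hRan : AnalyticSet R :=
    ((hA i).diff hCm).analyticSet.inter_analyticSet ((AnalyticSet.iInter fun j : Fin k =>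
      ((hA j).diff hCm).analyticSet.image_of_continuous hf).preimage hf)
  have hRinj : InjOn f R := by
    intro z hz z' hz' hzz
    by_contra hne
    obtain ⟨a, b, hab, ha, hb⟩ := hsep z z' hne
    have hsub : C ⟨(a, b), hab⟩ ⊆ E := subset_iUnion C _
    obtain ⟨j, hj, hjc⟩ := hcov ⟨(a, b), hab⟩ (f z) (by
      intro j hj
      rcases eq_or_ne j k with rfl | hjk
      · exact ⟨z', by rw [splitAt_right]; exact ⟨hz'.1.1, hb⟩, hzz.symm⟩
      rcases eq_or_ne j i with rfl | hji
      · exact ⟨z, by rw [splitAt_left _ hi]; exact ⟨hz.1.1, ha⟩, rfl⟩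
      obtain ⟨w, hw, hwz⟩ := mem_iInter.1 hz.2 ⟨j, by omega⟩
      exact ⟨w, by rw [splitAt_of_ne _ hji hjk]; exact hw.1, hwz⟩)
    rcases eq_or_ne j k with rfl | hjk
    · rw [splitAt_right] at hjc
      exact hz'.1.2 (hsub (hjc z' ⟨hz'.1.1, hb⟩ hzz.symm))
    rcases eq_or_ne j i with rfl | hji
    · rw [splitAt_left _ hi] at hjc
      exact hz.1.2 (hsub (hjc z ⟨hz.1.1, ha⟩ rfl))
    rw [splitAt_of_ne _ hji hjk] at hjc
    obtain ⟨w, hw, hwz⟩ := mem_iInter.1 hz.2 ⟨j, by omega⟩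
    exact hw.2 (hsub (hjc w hw.1 hwz))
  obtain ⟨B, hRB, hB, hBinj⟩ := exists_measurableSet_injOn_superset hf hU hsep hRan hRinj
  refine ⟨E ∪ B, hCu.union (.of_injOn hB hBinj), fun x _ => ?_⟩
  by_contra! hcon
  have hall : x ∈ ⋂ j : Fin k, f '' (A j \ E) := by
    refine mem_iInter.2 fun j => ?_
    obtain ⟨z, hz, hzx, hzE⟩ := hcon j j.2
    exact ⟨z, ⟨hz, fun h => hzE (.inl h)⟩, hzx⟩
  obtain ⟨z, hz, hzx, hzE⟩ := hcon i hi
  exact hzE (.inr (hRB ⟨⟨hz, fun h => hzE (.inl h)⟩, by rw [mem_preimage, hzx]; exact hall⟩))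

end Polish

/-- The balls have centres in a dense sequence. The cap `ε / 2` on the radius controls the diameter;
the bound `1 / (m + 1)` lets the radius shrink far enough to separate any two points. -/
theorem exists_countable_separating_closedBalls (Z : Type*) [MetricSpace Z]
    [SecondCountableTopology Z] {ε : ℝ} (hε : 0 < ε) :
    ∃ U : ℕ → Set Z, (∀ n, IsClosed (U n)) ∧ (∀ n, ∀ z ∈ U n, ∀ z' ∈ U n, dist z z' ≤ ε) ∧
      ∀ z z', z ≠ z' → ∃ i j, Disjoint (U i) (U j) ∧ z ∈ U i ∧ z' ∈ U j := by
  cases isEmpty_or_nonempty Z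
  · exact ⟨fun _ => ∅, by simp, by simp, fun z => isEmptyElim z⟩
  refine ⟨fun n => Metric.closedBall (TopologicalSpace.denseSeq Z n.unpair.1)
    (min (ε / 2) (1 / ((n.unpair.2 : ℝ) + 1))), fun n => Metric.isClosed_closedBall, ?_, ?_⟩
  · intro n z hz z' hz'
    have h1 := (Metric.mem_closedBall.1 hz).trans (min_le_left _ _)
    have h2 := (Metric.mem_closedBall.1 hz').trans (min_le_left _ _)
    linarith [dist_triangle_right z z' (TopologicalSpace.denseSeq Z n.unpair.1)]
  · intro z z' hne
    have hd : 0 < dist z z' / 4 := by have := dist_pos.2 hne; linarith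
    obtain ⟨m, hm⟩ := exists_nat_one_div_lt hd
    have hr : 0 < min (ε / 2) (1 / ((m : ℝ) + 1)) := by positivity
    obtain ⟨a, ha⟩ := (TopologicalSpace.denseRange_denseSeq Z).exists_dist_lt z hr
    obtain ⟨b, hb⟩ := (TopologicalSpace.denseRange_denseSeq Z).exists_dist_lt z' hr
    refine ⟨Nat.pair a m, Nat.pair b m, ?_, ?_, ?_⟩
    · simp only [Nat.unpair_pair]
      refine Metric.closedBall_disjoint_closedBall ?_
      have h1 := ha.le.trans (min_le_right _ _)
      have h2 := hb.le.trans (min_le_right _ _)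
      have h3 : min (ε / 2) (1 / ((m : ℝ) + 1)) ≤ 1 / ((m : ℝ) + 1) := min_le_right _ _
      have h4 := dist_triangle4 z (TopologicalSpace.denseSeq Z a) (TopologicalSpace.denseSeq Z b) z'
      rw [dist_comm (TopologicalSpace.denseSeq Z b) z'] at h4
      linarith
    · simpa using ha.le
    · simpa using hb.le

/-- If the domain of a continuous map is not a countable union of Borel sets on which the map is
injective, then some fibre contains a sequence whose range is dense in itself. -/
theorem exists_dense_in_itself_fiber {Z X : Type*} [MetricSpace Z] [CompleteSpace Z]
    [SecondCountableTopology Z] [MeasurableSpace Z] [BorelSpace Z]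
    [TopologicalSpace X] [PolishSpace X] [MeasurableSpace X] [BorelSpace X] {f : Z → X}
    (hf : Continuous f) (h : ¬ CountablyInjOn f univ) :
    ∃ z : ℕ → Z, (∀ i, f (z i) = f (z 0)) ∧
      ∀ i, ∀ ε > 0, ∃ j, z j ≠ z i ∧ dist (z j) (z i) ≤ ε := by
  -- Stage `n` splits the piece of index `n.unpair.1 ≤ n` and gives the new half index `n + 1`.
  -- Every index is split infinitely often.
  have step : ∀ (n : ℕ) (A : {A : ℕ → Set Z // (∀ j, IsClosed (A j)) ∧ ¬ FiberThin f (n + 1) A}),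
      ∃ A' : {A : ℕ → Set Z // (∀ j, IsClosed (A j)) ∧ ¬ FiberThin f (n + 1 + 1) A},
        (∀ j ≤ n, A'.1 j ⊆ A.1 j) ∧ A'.1 (n + 1) ⊆ A.1 n.unpair.1 ∧
        Disjoint (A'.1 n.unpair.1) (A'.1 (n + 1)) ∧
        ∀ p ∈ A'.1 n.unpair.1, ∀ q ∈ A'.1 n.unpair.1, dist p q ≤ 1 / ((n : ℝ) + 1) := by
    rintro n ⟨A, hA, hthin⟩
    obtain ⟨U, hU, hUd, hsep⟩ := exists_countable_separating_closedBalls Z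
      (ε := 1 / ((n : ℝ) + 1)) (by positivity)
    have hi : n.unpair.1 < n + 1 := Nat.lt_succ_of_le (Nat.unpair_left_le n)
    have : ∃ a b, Disjoint (U a) (U b) ∧
        ¬ FiberThin f (n + 1 + 1) (splitAt A n.unpair.1 (n + 1) (U a) (U b)) := by
      by_contra! hcon
      exact hthin (.of_splitAt hf (fun j => (hU j).measurableSet) hsep hi
        (fun j => (hA j).measurableSet) hcon)
    obtain ⟨a, b, hab, hn⟩ := this
    have hl := splitAt_left A hi (U a) (U b)
    have hr := splitAt_right A n.unpair.1 (n + 1) (U a) (U b)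
    refine ⟨⟨_, fun j => ?_, hn⟩, fun j hj => ?_, ?_, ?_, ?_⟩
    · rcases eq_or_ne j (n + 1) with rfl | hjk
      · rw [hr]; exact (hA _).inter (hU _)
      rcases eq_or_ne j n.unpair.1 with rfl | hji
      · rw [hl]; exact (hA _).inter (hU _)
      rw [splitAt_of_ne _ hji hjk]; exact hA j
    · by_cases hji : j = n.unpair.1
      · rw [hji]; exact hl.trans_subset inter_subset_left
      · exact (splitAt_of_ne _ hji (by omega) _ _).subset
    · exact hr.trans_subset inter_subset_left
    · change Disjoint (splitAt _ _ _ _ _ _) (splitAt _ _ _ _ _ _)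
      rw [hl, hr]
      exact hab.mono inter_subset_right inter_subset_right
    · intro p hp q hq
      exact hUd a p (hl.subset hp).2 q (hl.subset hq).2
  choose next hmono hnew hdisj hdist using step
  have h0 : ¬ FiberThin f (0 + 1) (fun _ => univ) := by
    rintro ⟨C, hC, hcov⟩
    refine h ?_
    have : C = univ := by
      refine eq_univ_of_forall fun z => ?_
      obtain ⟨_, _, hz⟩ := hcov (f z) fun i _ => ⟨z, trivial, rfl⟩
      exact hz z trivial rfl
    rwa [this] at hC
  let S : (n : ℕ) → {A : ℕ → Set Z // (∀ j, IsClosed (A j)) ∧ ¬ FiberThin f (n + 1) A} :=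
    fun n => Nat.rec ⟨fun _ => univ, fun _ => isClosed_univ, h0⟩ next n
  have hS : ∀ n, S (n + 1) = next n (S n) := fun _ => rfl
  have hanti : ∀ i m n, i ≤ m → m ≤ n → (S n).1 i ⊆ (S m).1 i := by
    intro i m n him hmn
    induction n, hmn using Nat.le_induction with
    | base => exact subset_rfl
    | succ n hmn ih => exact (hS n ▸ hmono n (S n) i (him.trans hmn)).trans ih
  -- Without a common value the empty cover would witness thinness.
  have hpt : ∀ n, ∃ x, ∀ i < n + 1, ∃ z ∈ (S n).1 i, f z = x := by
    intro n
    by_contra hcon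
    exact (S n).2.2 ⟨∅, .empty, fun x hx => absurd ⟨x, hx⟩ hcon⟩
  choose x hx using hpt
  have hZ : Nonempty Z := ⟨(hx 0 0 one_pos).choose⟩
  choose! a haS hax using hx
  have hsmall : ∀ i, ∀ ε > 0, ∀ N, ∃ m, N ≤ m ∧ i ≤ m ∧ m.unpair.1 = i ∧
      ∀ p ∈ (S (m + 1)).1 i, ∀ q ∈ (S (m + 1)).1 i, dist p q ≤ ε := by
    intro i ε hε N
    obtain ⟨M, hM⟩ := exists_nat_one_div_lt hε
    have hle := Nat.right_le_pair i (max M N)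
    refine ⟨Nat.pair i (max M N), (le_max_right _ _).trans hle, Nat.left_le_pair _ _, by simp, ?_⟩
    intro p hp q hq
    have := hdist (Nat.pair i (max M N)) (S _) p (by simpa [← hS] using hp) q
      (by simpa [← hS] using hq)
    refine this.trans (le_trans ?_ hM.le)
    refine one_div_le_one_div_of_le (by positivity) ?_
    have : (M : ℝ) ≤ (Nat.pair i (max M N) : ℕ) := by
      exact_mod_cast (le_max_left _ _).trans hle
    linarith
  have hlim : ∀ i, ∃ z, Tendsto (fun n => a n i) atTop (𝓝 z) := by
    intro i
    refine cauchySeq_tendsto_of_complete (Metric.cauchySeq_iff'.2 fun ε hε => ?_)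
    obtain ⟨m, -, him, -, hm⟩ := hsmall i (ε / 2) (half_pos hε) 0
    refine ⟨m + 1, fun n hn => (hm _ ?_ _ ?_).trans_lt (half_lt_self hε)⟩
    · exact hanti i (m + 1) n (by omega) hn (haS n i (by omega))
    · exact haS (m + 1) i (by omega)
  choose z hz using hlim
  have hzS : ∀ i n, i ≤ n → z i ∈ (S n).1 i := by
    intro i n hin
    refine ((S n).2.1 i).mem_of_tendsto (hz i) (eventually_atTop.2 ⟨n, fun m hm => ?_⟩)
    exact hanti i n m hin hm (haS m i (by omega))
  -- At stage `n` all chosen points `a n i` have the value `x n`, so all the limits `z i` lie in one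
  -- fibre.
  have hfz : ∀ i, Tendsto x atTop (𝓝 (f (z i))) := by
    intro i
    refine ((hf.tendsto _).comp (hz i)).congr' (eventually_atTop.2 ⟨i, fun n hn => ?_⟩)
    exact hax n i (by omega)
  refine ⟨z, fun i => tendsto_nhds_unique (hfz i) (hfz 0), fun i ε hε => ?_⟩
  -- Stage `m` makes the piece of index `i` small. A later stage `n` splits it again, putting `z (n
  -- + 1)` and `z i` into disjoint halves of that small piece.
  obtain ⟨m, -, him, -, hm⟩ := hsmall i ε hε 0
  obtain ⟨n, hmn, hin, hni, -⟩ := hsmall i ε hε (m + 1)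
  have hzn := hzS (n + 1) (n + 1) le_rfl
  refine ⟨n + 1, fun heq => ?_, hm _ ?_ _ (hzS i (m + 1) (by omega))⟩
  · refine Set.disjoint_left.1 (hdisj n (S n)) ?_ hzn
    rw [hni, ← hS, heq]
    exact hzS i (n + 1) (by omega)
  · have := hnew n (S n) hzn
    rw [hni] at this
    exact hanti i (m + 1) n (by omega) hmn this

/-- A continuous map between Polish spaces with countable fibres is injective on each of countably
many Borel sets covering its domain. -/
theorem countablyInjOn_univ_of_countable_fibers {Z X : Type*} [TopologicalSpace Z] [PolishSpace Z]
    [MeasurableSpace Z] [BorelSpace Z]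
    [TopologicalSpace X] [PolishSpace X] [MeasurableSpace X] [BorelSpace X] {f : Z → X}
    (hf : Continuous f) (hc : ∀ x, (f ⁻¹' {x}).Countable) : CountablyInjOn f univ := by
  let := TopologicalSpace.upgradeIsCompletelyMetrizable Z
  by_contra h
  obtain ⟨z, hz, hacc⟩ := exists_dense_in_itself_fiber hf h
  have hpre : Preperfect (range z) := by
    rw [preperfect_iff_nhds]
    rintro _ ⟨i, rfl⟩ U hU
    obtain ⟨ε, hε, hεU⟩ := Metric.nhds_basis_closedBall.mem_iff.1 hU
    obtain ⟨j, hj, hd⟩ := hacc i ε hε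
    exact ⟨z j, ⟨hεU hd, mem_range_self j⟩, hj⟩
  -- The closure is perfect and stays inside the closed fibre, which therefore contains an injective
  -- image of `ℕ → Bool`; a diagonal argument contradicts countability.
  obtain ⟨g, hg, -, hginj⟩ := hpre.perfect_closure.exists_nat_bool_injection
    ⟨z 0, subset_closure (mem_range_self 0)⟩
  have hsub : closure (range z) ⊆ f ⁻¹' {f (z 0)} :=
    closure_minimal (range_subset_iff.2 hz) (isClosed_singleton.preimage hf)
  have hct := ((hc (f (z 0))).mono (hg.trans hsub)).preimage_of_injOn (f := g) hginj.injOn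
  rw [preimage_range] at hct
  have := countable_univ_iff.1 hct
  obtain ⟨e, he⟩ := exists_surjective_nat (ℕ → Bool)
  obtain ⟨n, hn⟩ := he fun k => !(e k k)
  simpa using congrFun hn n

/-- The **Lusin–Novikov theorem**, for total relations: a Borel relation with countable nonempty
sections is enumerated by a sequence of Borel maps. -/
theorem exists_measurable_enumeration_of_countable_sections {X Y : Type*} [MeasurableSpace X]
    [StandardBorelSpace X] [MeasurableSpace Y] [StandardBorelSpace Y] {P : X → Y → Prop}
    (hP : MeasurableSet {p : X × Y | P p.1 p.2}) (hc : ∀ x, {y | P x y}.Countable)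
    {s : X → Y} (hs : Measurable s) (hsP : ∀ x, P x (s x)) :
    ∃ F : ℕ → X → Y, (∀ n, Measurable (F n)) ∧ ∀ x y, P x y ↔ ∃ n, F n x = y := by
  classical
  let Z := {p : X × Y // P p.1 p.2}
  have : StandardBorelSpace Z := hP.standardBorel
  let hZ := upgradeStandardBorel Z
  let := upgradeStandardBorel X
  have hfst : Measurable fun z : Z => z.1.1 := measurable_fst.comp measurable_subtype_coe
  have hsnd : Measurable fun z : Z => z.1.2 := measurable_snd.comp measurable_subtype_coe
  -- Refine the Polish topology of `Z` to make the projection continuous; the Borel sets stay the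
  -- same.
  obtain ⟨t', ht', hcont, hpol⟩ := hfst.exists_continuous
  have hbor : @BorelSpace Z t' inferInstance := by
    refine @BorelSpace.mk Z t' _ ?_
    refine (@BorelSpace.measurable_eq Z hZ.toTopologicalSpace _ _).trans ?_
    exact (@borel_eq_borel_of_le Z t' hZ.toTopologicalSpace hpol inferInstance ht').symm
  have key : CountablyInjOn (fun z : Z => z.1.1) univ := by
    refine @countablyInjOn_univ_of_countable_fibers Z X t' hpol _ hbor _ _ _ _ _ hcont fun x => ?_
    refine ((hc x).image fun y => (x, y)).preimage Subtype.val_injective |>.mono ?_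
    rintro ⟨⟨x', y⟩, hz⟩ rfl
    exact ⟨y, hz, rfl⟩
  obtain ⟨D, hD, hinj, hun⟩ := key
  -- `F n` inverts the projection on `D n` and defaults to `s` off its image. Images of Borel
  -- subsets of `D n` are Borel by Lusin–Souslin.
  refine ⟨fun n x => if h : ∃ z ∈ D n, z.1.1 = x then h.choose.1.2 else s x, fun n => ?_,
    fun x y => ⟨fun h => ?_, ?_⟩⟩
  · intro B hB
    have : (fun x => if h : ∃ z ∈ D n, z.1.1 = x then h.choose.1.2 else s x) ⁻¹' B =
        ((fun z : Z => z.1.1) '' (D n ∩ (fun z : Z => z.1.2) ⁻¹' B)) ∪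
          (((fun z : Z => z.1.1) '' D n)ᶜ ∩ s ⁻¹' B) := by
      ext x
      by_cases h : ∃ z ∈ D n, z.1.1 = x
      · have h' := h.choose_spec
        simp only [mem_preimage, dif_pos h, mem_union, mem_inter_iff, mem_compl_iff]
        constructor
        · exact fun hB => .inl ⟨h.choose, ⟨h'.1, hB⟩, h'.2⟩
        · rintro (⟨z, ⟨hz, hzB⟩, hzx⟩ | ⟨h1, -⟩)
          · rwa [hinj n h'.1 hz (h'.2.trans hzx.symm)]
          · exact absurd h h1
      · simp only [mem_preimage, dif_neg h, mem_union, mem_inter_iff, mem_compl_iff]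
        constructor
        · exact fun hB => .inr ⟨h, hB⟩
        · rintro (⟨z, ⟨hz, -⟩, hzx⟩ | ⟨-, h1⟩)
          · exact absurd ⟨z, hz, hzx⟩ h
          · exact h1
    rw [this]
    exact (((hD n).inter (hsnd hB)).image_of_measurable_injOn hfst
      ((hinj n).mono inter_subset_left)).union
      (((hD n).image_of_measurable_injOn hfst (hinj n)).compl.inter (hs hB))
  · obtain ⟨n, hn⟩ := mem_iUnion.1 (hun.subset (mem_univ (⟨(x, y), h⟩ : Z)))
    have hex : ∃ z ∈ D n, z.1.1 = x := ⟨_, hn, rfl⟩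
    refine ⟨n, ?_⟩
    simp only [dif_pos hex]
    rw [hinj n hex.choose_spec.1 hn hex.choose_spec.2]
  · rintro ⟨n, rfl⟩
    by_cases h : ∃ z ∈ D n, z.1.1 = x
    · simp only [dif_pos h]
      have := h.choose.2
      rwa [h.choose_spec.2] at this
    · simpa only [dif_neg h] using hsP x

end LusinNovikov

/-! ### Coding orbits by positive words in a free group -/

section FreeCoding

open Set

/-- The element of the free group given by a positive word. -/
def FreeGroup.ofPositive {L : Type*} (l : List L) : FreeGroup L :=
  FreeGroup.mk (l.map fun a => (a, true))

namespace FreeGroup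

variable {L : Type*}

theorem ofPositive_cons (a : L) (l : List L) : ofPositive (a :: l) = of a * ofPositive l := rfl

theorem ofPositive_append (l l' : List L) :
    ofPositive (l ++ l') = ofPositive l * ofPositive l' := by
  simp [ofPositive]

theorem isReduced_map_true (l : List L) : IsReduced (l.map fun a => (a, true)) := by
  rw [IsReduced, List.isChain_map]
  induction l with
  | nil => simp
  | cons a l ih => cases l <;> simp_all

theorem eq_of_mk_eq_mk {w w' : List (L × Bool)} (h : mk w = mk w') (hw : IsReduced w)
    (hw' : IsReduced w') : w = w' := by
  classical
  have := congrArg toWord h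
  rwa [toWord_mk, toWord_mk, hw.reduce_eq, hw'.reduce_eq] at this

theorem ofPositive_injective : Function.Injective (ofPositive : List L → FreeGroup L) := by
  intro l l' h
  have := eq_of_mk_eq_mk h (isReduced_map_true l) (isReduced_map_true l')
  exact List.map_injective_iff.2 (fun a b h => congrArg Prod.fst h) this

theorem isReduced_cons_false {a : L} {l : List L} (h : l.head? ≠ some a) :
    IsReduced ((a, false) :: l.map fun a => (a, true)) := by
  cases l with
  | nil => exact .singleton
  | cons b l =>
    refine isReduced_cons_cons.2 ⟨fun hab => absurd ?_ h, isReduced_map_true (b :: l)⟩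
    simpa using Eq.symm hab

theorem isReduced_concat_false {a : L} {l : List L} (h : l.getLast? ≠ some a) :
    IsReduced ((l.map fun a => (a, true)) ++ [(a, false)]) := by
  rw [IsReduced, List.isChain_append]
  refine ⟨isReduced_map_true l, .singleton _, ?_⟩
  intro x hx y hy hxy
  simp only [List.getLast?_map, Option.mem_def, Option.map_eq_some_iff] at hx
  obtain ⟨b, hb, rfl⟩ := hx
  obtain rfl : (a, false) = y := by simpa using hy
  by_contra
  obtain rfl : b = a := hxy
  exact h hb

/-- If two different letters map `g` to positive elements by left multiplication,
then `g` is positive. -/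
theorem exists_ofPositive_of_of_mul {a b : L} (hab : a ≠ b) {g : FreeGroup L} {l l' : List L}
    (h : of a * g = ofPositive l) (h' : of b * g = ofPositive l') : ∃ m, g = ofPositive m := by
  by_cases hl : l.head? = some a
  · obtain ⟨m, rfl⟩ := List.head?_eq_some_iff.1 hl
    exact ⟨m, mul_left_cancel h⟩
  by_cases hl' : l'.head? = some b
  · obtain ⟨m, rfl⟩ := List.head?_eq_some_iff.1 hl'
    exact ⟨m, mul_left_cancel h'⟩
  -- With no cancellation on either side, `g` would have two reduced words starting with different
  -- inverse letters.
  have h1 : g = mk ((a, false) :: l.map fun a => (a, true)) := by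
    rw [← inv_mul_eq_iff_eq_mul.2 h.symm]; rfl
  have h2 : g = mk ((b, false) :: l'.map fun a => (a, true)) := by
    rw [← inv_mul_eq_iff_eq_mul.2 h'.symm]; rfl
  have := eq_of_mk_eq_mk (h1.symm.trans h2) (isReduced_cons_false hl) (isReduced_cons_false hl')
  simp at this
  exact absurd this.1 hab

/-- If two different letters map `g` to positive elements by right multiplication,
then `g` is positive. -/
theorem exists_ofPositive_of_mul_of {a b : L} (hab : a ≠ b) {g : FreeGroup L} {l l' : List L}
    (h : g * of a = ofPositive l) (h' : g * of b = ofPositive l') : ∃ m, g = ofPositive m := by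
  by_cases hl : l.getLast? = some a
  · obtain ⟨m, rfl⟩ := List.getLast?_eq_some_iff.1 hl
    exact ⟨m, mul_right_cancel (h.trans (ofPositive_append m [a]))⟩
  by_cases hl' : l'.getLast? = some b
  · obtain ⟨m, rfl⟩ := List.getLast?_eq_some_iff.1 hl'
    exact ⟨m, mul_right_cancel (h'.trans (ofPositive_append m [b]))⟩
  have h1 : g = mk ((l.map fun a => (a, true)) ++ [(a, false)]) := by
    rw [eq_mul_inv_of_mul_eq h]; rfl
  have h2 : g = mk ((l'.map fun a => (a, true)) ++ [(b, false)]) := by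
    rw [eq_mul_inv_of_mul_eq h']; rfl
  have := eq_of_mk_eq_mk (h1.symm.trans h2) (isReduced_concat_false hl)
    (isReduced_concat_false hl')
  have := congrArg List.getLast? this
  simp at this
  exact absurd this hab

/-- The action of `ℤ` on the free group over `ℤ` by translation of the generators. -/
def shiftAut : Multiplicative ℤ →* MulAut (FreeGroup ℤ) where
  toFun z := freeGroupCongr (Equiv.addLeft z.toAdd)
  map_one' := MulEquiv.toMonoidHom_injective (by ext; simp)
  map_mul' z w := MulEquiv.toMonoidHom_injective (by ext; simp [add_assoc])

/-- A nonabelian free group contains a free group of countably infinite rank. -/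
theorem exists_injective_of_noncomm {F : Type*} [Group F] [IsFreeGroup F]
    (h : ∃ x y : F, x * y ≠ y * x) : ∃ f : FreeGroup ℤ →* F, Function.Injective f := by
  let e := IsFreeGroup.toFreeGroup F
  have hnt : Nontrivial (IsFreeGroup.Generators F) := by
    by_contra hcon
    rw [not_nontrivial_iff_subsingleton] at hcon
    obtain ⟨x, y, hxy⟩ := h
    refine hxy (e.injective ?_)
    rw [e.map_mul, e.map_mul]
    generalize e x = u
    generalize e y = v
    cases isEmpty_or_nonempty (IsFreeGroup.Generators F) with
    | inl _ => exact Subsingleton.elim _ _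
    | inr hne =>
      let _ : Unique (IsFreeGroup.Generators F) := @Unique.mk' _ ⟨hne.some⟩ hcon
      apply (mulEquivIntOfUnique (α := IsFreeGroup.Generators F)).injective
      rw [MulEquiv.map_mul, MulEquiv.map_mul, mul_comm]
  classical
  obtain ⟨s, t, hst⟩ := hnt
  -- `Ψ` sends `s` to the shift and `t` to the generator `of 0`, so it sends the conjugate of `t` by
  -- `s ^ z` to `of z`. These conjugates are therefore free generators.
  let Ψ : F →* FreeGroup ℤ ⋊[shiftAut] Multiplicative ℤ :=
    (FreeGroup.lift fun a => if a = s then SemidirectProduct.inr (Multiplicative.ofAdd 1)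
      else SemidirectProduct.inl (of 0)).comp e.toMonoidHom
  let f : FreeGroup ℤ →* F := FreeGroup.lift fun z =>
    e.symm (of s) ^ z * e.symm (of t) * (e.symm (of s) ^ z)⁻¹
  refine ⟨f, ?_⟩
  have hΨ : Ψ.comp f = SemidirectProduct.inl := by
    ext1 z
    have hs : Ψ (e.symm (of s)) = SemidirectProduct.inr (Multiplicative.ofAdd 1) := by simp [Ψ]
    have ht : Ψ (e.symm (of t)) = SemidirectProduct.inl (of 0) := by simp [Ψ, hst.symm]
    have hz : of z = shiftAut (Multiplicative.ofAdd z) (of 0) := by simp [shiftAut]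
    rw [MonoidHom.comp_apply, FreeGroup.lift_apply_of, hz, SemidirectProduct.inl_aut]
    change Ψ (_ * _ * _⁻¹) = _
    rw [_root_.map_mul, _root_.map_mul,
      _root_.map_inv, _root_.map_zpow, hs, ht, ← _root_.map_zpow, ← ofAdd_zsmul, _root_.map_inv]
    simp
  refine Function.Injective.of_comp (f := Ψ) ?_
  rw [← MonoidHom.coe_comp, hΨ]
  exact SemidirectProduct.inl_injective

end FreeGroup

/-- Letters: pairs on the left encode the maps `F n` (in two copies), those on the right encode the
coordinates of a point of the Cantor space. -/
abbrev OrbitLetter : Type := (ℕ × Bool) ⊕ (ℕ × Bool)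

section

variable {X : Type*} (F : ℕ → X → X) (β : X → ℕ → Bool)

/-- The word `l` codes a true statement about `x`: apply the maps named by the letters on the left,
and compare a coordinate with the last letter. -/
def CodesTrue : List OrbitLetter → X → Prop
  | [], _ => False
  | .inl n :: l, x => CodesTrue l (F n.1 x)
  | .inr k :: l, x => l = [] ∧ β x k.1 = k.2

/-- The subset of a free group coding the orbit of `x` under the maps `F n`. -/
def orbitCode (x : X) : Set (FreeGroup OrbitLetter) :=
  FreeGroup.ofPositive '' {l | CodesTrue F β l x}

variable {F β}

theorem ofPositive_mem_orbitCode {x : X} {l : List OrbitLetter} :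
    FreeGroup.ofPositive l ∈ orbitCode F β x ↔ CodesTrue F β l x :=
  FreeGroup.ofPositive_injective.mem_set_image

theorem measurableSet_codesTrue [MeasurableSpace X] (hF : ∀ n, Measurable (F n))
    (hβ : Measurable β) (l : List OrbitLetter) : MeasurableSet {x | CodesTrue F β l x} := by
  induction l with
  | nil => exact .empty
  | cons a l ih =>
    cases a with
    | inl n => exact hF n.1 ih
    | inr k =>
      exact (MeasurableSet.const _).inter
        (((measurable_pi_apply k.1).comp hβ) (measurableSet_singleton k.2))

theorem measurableSet_mem_orbitCode [MeasurableSpace X] (hF : ∀ n, Measurable (F n))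
    (hβ : Measurable β) (g : FreeGroup OrbitLetter) : MeasurableSet {x | g ∈ orbitCode F β x} := by
  by_cases h : ∃ l, FreeGroup.ofPositive l = g
  · obtain ⟨l, rfl⟩ := h
    simpa only [ofPositive_mem_orbitCode] using measurableSet_codesTrue hF hβ l
  · convert MeasurableSet.empty
    exact eq_empty_of_forall_notMem fun x ⟨l, _, hl⟩ => h ⟨l, hl⟩

theorem orbitCode_infinite (x : X) : (orbitCode F β x).Infinite := by
  refine Set.infinite_of_injective_forall_mem
    (f := fun k : ℕ => FreeGroup.ofPositive [(.inr (k, β x k) : OrbitLetter)]) ?_ ?_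
  · intro k k' h
    have := FreeGroup.ofPositive_injective h
    simp only [List.cons.injEq, Sum.inr.injEq, Prod.mk.injEq] at this
    exact this.1.1
  · exact fun k => ⟨[.inr (k, β x k)], ⟨rfl, rfl⟩, rfl⟩

/-- With a single letter `a`, a nonpositive element `a⁻¹ * w` could also be carried into the code.
Requiring membership for two different letters forces `g` to be positive. -/
theorem mem_orbitCode_map_iff (n : ℕ) (x : X) (g : FreeGroup OrbitLetter) :
    g ∈ orbitCode F β (F n x) ↔
      ∀ b, FreeGroup.of (.inl (n, b) : OrbitLetter) * g ∈ orbitCode F β x := by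
  constructor
  · rintro ⟨l, hl, rfl⟩ b
    rw [← FreeGroup.ofPositive_cons, ofPositive_mem_orbitCode]
    exact hl
  · intro h
    obtain ⟨l, -, hl⟩ := h false
    obtain ⟨l', -, hl'⟩ := h true
    obtain ⟨m, rfl⟩ := FreeGroup.exists_ofPositive_of_of_mul (by simp) hl.symm hl'.symm
    have := h false
    rw [← FreeGroup.ofPositive_cons, ofPositive_mem_orbitCode] at this
    exact ofPositive_mem_orbitCode.2 this

/-- The point `x'` is reached from `x` by the maps named in `l`, so it does not depend on the final
letter. A coordinate letter inside `l` is impossible, since such a letter must be last. -/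
theorem CodesTrue.exists_point {Q : X → X → Prop} (hrefl : ∀ x, Q x x)
    (htrans : ∀ x y z, Q x y → Q y z → Q x z) (hFQ : ∀ n x, Q (F n x) x)
    (l : List OrbitLetter) (k : ℕ × Bool) (x : X) (h : CodesTrue F β (l ++ [.inr k]) x) :
    ∃ x', Q x' x ∧ ∀ k', CodesTrue F β (l ++ [.inr k']) x → β x' k'.1 = k'.2 := by
  induction l generalizing x with
  | nil => exact ⟨x, hrefl x, fun k' hk' => hk'.2⟩
  | cons a l ih =>
    cases a with
    | inl n =>
      obtain ⟨x', hx', hk⟩ := ih (F n.1 x) h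
      exact ⟨x', htrans _ _ _ hx' (hFQ _ _), hk⟩
    | inr k => exact absurd h.1 (by simp)

/-- The singleton words recording the coordinates of `β y` are in the code of `y`. Their translates
for two coordinates force `h` to be a positive word, and the point it leads to from `x` has all the
coordinates of `y`. -/
theorem rel_of_orbitCode_subset {Q : X → X → Prop} (hrefl : ∀ x, Q x x)
    (htrans : ∀ x y z, Q x y → Q y z → Q x z) (hFQ : ∀ n x, Q (F n x) x)
    (hβ : Function.Injective β) {x y : X} (h : FreeGroup OrbitLetter)
    (hsub : ∀ g ∈ orbitCode F β y, h * g ∈ orbitCode F β x) : Q y x := by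
  have hmem : ∀ k, h * FreeGroup.of (.inr (k, β y k) : OrbitLetter) ∈ orbitCode F β x :=
    fun k => hsub _ ⟨[.inr (k, β y k)], ⟨rfl, rfl⟩, rfl⟩
  obtain ⟨l, -, hl⟩ := hmem 0
  obtain ⟨l', -, hl'⟩ := hmem 1
  obtain ⟨m, rfl⟩ := FreeGroup.exists_ofPositive_of_mul_of (by simp) hl.symm hl'.symm
  have hm : ∀ k, CodesTrue F β (m ++ [.inr (k, β y k)]) x := fun k => by
    rw [← ofPositive_mem_orbitCode (F := F), FreeGroup.ofPositive_append]
    exact hmem k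
  obtain ⟨x', hx', hk⟩ := CodesTrue.exists_point hrefl htrans hFQ m _ x (hm 0)
  rwa [hβ (funext fun k => (hk _ (hm k)).symm : β y = β x')]

end

end FreeCoding

/-! ### The countable Borel quasi-order on the space of subgroups -/

section ConjIntersection

open Set

section

variable {Γ : Type*} [Group Γ]

theorem mem_iInf_map_conj {n : ℕ} {B : Subgroup Γ} {g : Fin (n + 1) → Γ} {γ : Γ} :
    γ ∈ ⨅ i, B.map (MulAut.conj (g i)).toMonoidHom ↔ ∀ i, (g i)⁻¹ * γ * g i ∈ B := by
  simp only [Subgroup.mem_iInf]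
  refine forall_congr' fun i => ?_
  constructor
  · rintro ⟨b, hb, rfl⟩
    simpa [mul_assoc] using hb
  · exact fun h => ⟨_, h, by simp [mul_assoc]⟩

/-- For countable `Γ` the witnesses range over a countable type, so the relation is visibly Borel.
-/
theorem conjIntersection_iff {A B : Subgroup Γ} : ConjIntersection A B ↔
    ∃ p : Σ n : ℕ, Fin (n + 1) → Γ, ∀ γ, γ ∈ A ↔ ∀ i, (p.2 i)⁻¹ * γ * p.2 i ∈ B := by
  simp only [ConjIntersection, SetLike.ext_iff, mem_iInf_map_conj, Sigma.exists]

theorem ConjIntersection.of_fintype {A B : Subgroup Γ} {ι : Type*} [Finite ι] [Nonempty ι]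
    (g : ι → Γ) (h : ∀ γ, γ ∈ A ↔ ∀ i, (g i)⁻¹ * γ * g i ∈ B) : ConjIntersection A B := by
  obtain ⟨n, ⟨e⟩⟩ := Finite.exists_equiv_fin ι
  cases n with
  | zero => exact (e (Classical.arbitrary ι)).elim0
  | succ n =>
    refine conjIntersection_iff.2 ⟨⟨n, g ∘ e.symm⟩, fun γ => (h γ).trans ?_⟩
    exact (e.symm.forall_congr_right (q := fun i => (g i)⁻¹ * γ * g i ∈ B)).symm

theorem ConjIntersection.refl (A : Subgroup Γ) : ConjIntersection A A :=
  .of_fintype (fun _ : Unit => 1) (by simp)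

theorem ConjIntersection.trans {A B C : Subgroup Γ} (h : ConjIntersection A B)
    (h' : ConjIntersection B C) : ConjIntersection A C := by
  obtain ⟨⟨n, g⟩, hg⟩ := conjIntersection_iff.1 h
  obtain ⟨⟨m, k⟩, hk⟩ := conjIntersection_iff.1 h'
  refine .of_fintype (fun p : Fin (n + 1) × Fin (m + 1) => g p.1 * k p.2) fun γ => ?_
  simp only [hg, hk, Prod.forall, mul_inv_rev, mul_assoc]

theorem measurableSet_mem_subgroup (γ : Γ) : MeasurableSet {A : Subgroup Γ | γ ∈ A} :=
  ⟨{s | γ ∈ s}, measurableSet_setOfPred.2 (measurable_set_mem γ), rfl⟩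

theorem measurable_subgroup_iff {X : Type*} [MeasurableSpace X] {f : X → Subgroup Γ} :
    Measurable f ↔ ∀ γ, MeasurableSet {x | γ ∈ f x} := by
  refine ⟨fun h γ => h (measurableSet_mem_subgroup γ), fun h => ?_⟩
  rw [measurable_comap_iff, measurable_set_iff]
  exact fun γ => measurableSet_setOfPred.1 (h γ)

variable [Countable Γ]

theorem measurableSet_range_subgroup_coe :
    MeasurableSet (range (fun A : Subgroup Γ => (A : Set Γ))) := by
  have hm : ∀ γ : Γ, MeasurableSet {s : Set Γ | γ ∈ s} :=
    fun γ => measurableSet_setOfPred.2 (measurable_set_mem γ)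
  have : range (fun A : Subgroup Γ => (A : Set Γ)) =
      {s | 1 ∈ s} ∩ ((⋂ a, {s | a ∈ s}ᶜ ∪ {s | a⁻¹ ∈ s}) ∩
        ⋂ a, ⋂ b, ({s | a ∈ s}ᶜ ∪ ({s | b ∈ s}ᶜ ∪ {s | a * b ∈ s}))) := by
    ext s
    simp only [mem_range, mem_inter_iff, mem_iInter, mem_union, mem_compl_iff, mem_ofPred_eq,
      ← imp_iff_not_or]
    constructor
    · rintro ⟨A, rfl⟩
      exact ⟨A.one_mem, fun a => A.inv_mem, fun a b => A.mul_mem⟩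
    · rintro ⟨h1, hi, hmul⟩
      exact ⟨{ carrier := s, one_mem' := h1, inv_mem' := hi _, mul_mem' := hmul _ _ }, rfl⟩
  rw [this]
  exact (hm 1).inter ((MeasurableSet.iInter fun a => (hm a).compl.union (hm _)).inter
    (.iInter fun a => .iInter fun b => (hm a).compl.union ((hm b).compl.union (hm _))))

instance Subgroup.instStandardBorelSpace : StandardBorelSpace (Subgroup Γ) := by
  have : StandardBorelSpace (Set Γ) := inferInstanceAs (StandardBorelSpace (Γ → Prop))
  have := (measurableSet_range_subgroup_coe (Γ := Γ)).standardBorel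
  let := upgradeStandardBorel (range fun A : Subgroup Γ => (A : Set Γ))
  let e := Equiv.ofInjective _ (SetLike.coe_injective (A := Subgroup Γ) (B := Γ))
  refine ⟨.induced e inferInstance, @BorelSpace.mk _ (_) _ ?_, e.polishSpace_induced⟩
  rw [borel_comap, ← BorelSpace.measurable_eq]
  exact (MeasurableSpace.comap_comp (f := Subtype.val) (g := e)).symm

theorem isCountableBorelQuasiOrder_conjIntersection :
    IsCountableBorelQuasiOrder (ConjIntersection (G := Γ)) where
  standardBorel := inferInstance
  refl := .refl
  trans _ _ _ := .trans
  borel := by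
    simp only [conjIntersection_iff, ofPred_exists, ofPred_forall]
    refine .iUnion fun p => .iInter fun γ => ?_
    have h1 : MeasurableSet {q : Subgroup Γ × Subgroup Γ | γ ∈ q.1} :=
      measurable_fst (measurableSet_mem_subgroup γ)
    have h2 : MeasurableSet {q : Subgroup Γ × Subgroup Γ | ∀ i, (p.2 i)⁻¹ * γ * p.2 i ∈ q.2} := by
      rw [ofPred_forall]
      exact .iInter fun i => measurable_snd (measurableSet_mem_subgroup _)
    rw [measurableSet_setOfPred] at *
    exact h1.iff h2
  countable_predecessors B := by
    refine (countable_range fun p : Σ n : ℕ, Fin (n + 1) → Γ =>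
      ⨅ i, B.map (MulAut.conj (p.2 i)).toMonoidHom).mono ?_
    rintro A ⟨n, g, rfl⟩
    exact ⟨⟨n, g⟩, rfl⟩

theorem measurableSet_infinite_subgroups :
    MeasurableSet {A : Subgroup Γ | (A : Set Γ).Infinite} := by
  have : {A : Subgroup Γ | (A : Set Γ).Infinite} = ⋂ s : Finset Γ, ⋃ γ : {γ // γ ∉ s},
      {A : Subgroup Γ | γ.1 ∈ A} := by
    ext A
    simp only [mem_ofPred_eq, mem_iInter, mem_iUnion, Subtype.exists, exists_prop]
    constructor
    · intro h s
      obtain ⟨a, ha, has⟩ := h.exists_notMem_finset s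
      exact ⟨a, has, ha⟩
    · intro h hfin
      obtain ⟨a, ha, haA⟩ := h hfin.toFinset
      exact ha (hfin.mem_toFinset.2 haA)
  rw [this]
  exact .iInter fun s => .iUnion fun γ => measurableSet_mem_subgroup _

theorem isCountableBorelQuasiOrder_conjIntersectionInfinite :
    IsCountableBorelQuasiOrder (ConjIntersectionInfinite (G := Γ)) where
  standardBorel := measurableSet_infinite_subgroups.standardBorel
  refl _ := .refl _
  trans _ _ _ := .trans
  borel := (measurable_subtype_coe.prodMap measurable_subtype_coe)
    (isCountableBorelQuasiOrder_conjIntersection (Γ := Γ)).borel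
  countable_predecessors B :=
    ((isCountableBorelQuasiOrder_conjIntersection (Γ := Γ)).countable_predecessors B.1).preimage
      Subtype.val_injective

end

end ConjIntersection

/-! ### From subsets of `G` to subgroups of `G ∗ H` -/

section FreePower

open Set Monoid

section

variable {G : Type*} {H : Type*} [Group H]

variable (G H) in
/-- The free product of copies of `H` indexed by `G`. -/
abbrev FreePower : Type _ := CoprodI fun _ : G => H

namespace FreePower

/-- The element `h` of the factor of index `a`. -/
abbrev of (a : G) : H →* FreePower G H := CoprodI.of (M := fun _ : G => H) (i := a)

open Classical in
/-- The retraction killing the factors with index outside `A`. -/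
noncomputable def retract (A : Set G) : FreePower G H →* FreePower G H :=
  CoprodI.lift fun a => if a ∈ A then of a else 1

open Classical in
@[simp]
theorem retract_of (A : Set G) (a : G) (h : H) :
    retract A (of a h) = if a ∈ A then of a h else 1 := by
  rw [retract, CoprodI.lift_of]
  split_ifs <;> rfl

open Classical in
/-- The projection to the factor of index `a`. -/
noncomputable def proj (a : G) : FreePower G H →* H := CoprodI.lift fun b => if b = a then .id H else 1

open Classical in
@[simp]
theorem proj_of (a b : G) (h : H) : proj a (of b h) = if b = a then h else 1 := by
  rw [proj, CoprodI.lift_of]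
  split_ifs <;> rfl

theorem retract_retract (A B : Set G) (n : FreePower G H) :
    retract A (retract B n) = retract (A ∩ B) n := by
  refine DFunLike.congr_fun (f := (retract A).comp (retract B))
    (CoprodI.ext_hom _ _ fun a => MonoidHom.ext fun h => ?_) n
  by_cases hB : a ∈ B <;> by_cases hA : a ∈ A <;> simp [hA, hB]

theorem proj_retract {a : G} {B : Set G} (h : a ∉ B) (n : FreePower G H) :
    proj a (retract B n) = 1 := by
  refine DFunLike.congr_fun (f := (proj a).comp (retract B)) (g := 1)
    (CoprodI.ext_hom _ _ fun b => MonoidHom.ext fun k => ?_) n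
  by_cases hB : b ∈ B
  · have : b ≠ a := fun e => h (e ▸ hB)
    simp [hB, this]
  · simp [hB]

/-- Composing the retractions for `A` and `B` gives the one for `A ∩ B`. This is what turns
intersections of sets into intersections of subgroups. -/
theorem retract_inter_eq_iff (A B : Set G) (n : FreePower G H) :
    retract (A ∩ B) n = n ↔ retract A n = n ∧ retract B n = n := by
  constructor
  · intro h
    constructor <;> nth_rewrite 1 [← h] <;> rw [retract_retract]
    · rwa [← inter_assoc, inter_self]
    · rwa [inter_left_comm, inter_self]
  · rintro ⟨hA, hB⟩
    rw [← retract_retract, hB, hA]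

theorem of_left_injective {h : H} (hh : h ≠ 1) :
    Function.Injective fun a : G => (of a h : FreePower G H) := by
  intro a b hab
  by_contra hne
  have := congrArg (proj b) hab
  simp [hne] at this
  exact hh this.symm

variable [Group G]

/-- Permute the factors by left translation by `g`. -/
def translate (g : G) : FreePower G H →* FreePower G H := CoprodI.lift fun a => of (g * a)

@[simp]
theorem translate_of (g a : G) (h : H) : translate g (of a h) = of (g * a) h :=
  CoprodI.lift_of ..

theorem translate_one : translate (1 : G) = MonoidHom.id (FreePower G H) :=
  CoprodI.ext_hom _ _ fun a => MonoidHom.ext fun h => by simp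

theorem translate_mul (g g' : G) :
    (translate (g * g') : FreePower G H →* _) = (translate g).comp (translate g') :=
  CoprodI.ext_hom _ _ fun a => MonoidHom.ext fun h => by simp [mul_assoc]

variable (G H) in
/-- The action of `G` on the free power by left translation of the factors. -/
def translateAut : G →* MulAut (FreePower G H) where
  toFun g := MonoidHom.toMulEquiv (translate g) (translate g⁻¹)
    (by rw [← translate_mul, inv_mul_cancel, translate_one])
    (by rw [← translate_mul, mul_inv_cancel, translate_one])
  map_one' := MulEquiv.ext fun n => DFunLike.congr_fun translate_one n
  map_mul' g g' := MulEquiv.ext fun n => DFunLike.congr_fun (translate_mul g g') n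

@[simp]
theorem translateAut_apply (g : G) (n : FreePower G H) : translateAut G H g n = translate g n := rfl

theorem translate_retract (g : G) (B : Set G) (n : FreePower G H) :
    translate g (retract {a | g * a ∈ B} n) = retract B (translate g n) := by
  refine DFunLike.congr_fun (f := (translate g).comp (retract _)) (g := (retract B).comp _)
    (CoprodI.ext_hom _ _ fun a => MonoidHom.ext fun h => ?_) n
  by_cases hB : g * a ∈ B <;> simp [hB]

open Classical in
theorem proj_translate (g a : G) (n : FreePower G H) :
    proj a (translate g n) = proj (g⁻¹ * a) n := by
  refine DFunLike.congr_fun (f := (proj a).comp (translate g))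
    (CoprodI.ext_hom _ _ fun b => MonoidHom.ext fun k => ?_) n
  change proj a (translate g (of b k)) = proj (g⁻¹ * a) (of b k)
  rw [translate_of, proj_of, proj_of]
  exact if_congr eq_inv_mul_iff_mul_eq.symm rfl rfl

theorem translate_injective (g : G) : Function.Injective (translate (H := H) g) :=
  (translateAut G H g).injective

theorem retract_translate_eq_iff (g : G) (B : Set G) (n : FreePower G H) :
    retract B (translate g n) = translate g n ↔ retract {a | g * a ∈ B} n = n := by
  rw [← translate_retract, (translate_injective g).eq_iff]

/-- The embedding in `G ∗ H` mapping the factor of index `a` to the conjugate of `H` by `a`. -/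
def toCoprod : FreePower G H →* Coprod G H :=
  CoprodI.lift fun a => (MulAut.conj (Coprod.inl a)).toMonoidHom.comp Coprod.inr

@[simp]
theorem toCoprod_of (a : G) (h : H) :
    toCoprod (of a h) = Coprod.inl a * Coprod.inr h * (Coprod.inl a)⁻¹ := by
  rw [toCoprod, CoprodI.lift_of]; rfl

/-- The homomorphism from `G ∗ H` to the semidirect product of the free power with `G`. -/
def ofCoprod : Coprod G H →* FreePower G H ⋊[translateAut G H] G :=
  Coprod.lift SemidirectProduct.inr (SemidirectProduct.inl.comp (of 1))

/-- Conjugation by `inr a` in the semidirect product is translation by `a`, so both sides agree on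
each factor. Injectivity of `toCoprod` follows. -/
theorem ofCoprod_toCoprod (n : FreePower G H) :
    ofCoprod (toCoprod n) = SemidirectProduct.inl n := by
  refine DFunLike.congr_fun (f := ofCoprod.comp toCoprod)
    (CoprodI.ext_hom _ _ fun a => MonoidHom.ext fun h => ?_) n
  have : of a h = translateAut G H a (of 1 h) := by simp
  change ofCoprod (toCoprod (of a h)) = SemidirectProduct.inl (of a h)
  rw [this, SemidirectProduct.inl_aut, ← this, toCoprod_of]
  simp [ofCoprod]

theorem toCoprod_injective : Function.Injective (toCoprod : FreePower G H →* Coprod G H) := by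
  intro n m h
  have := congrArg ofCoprod h
  rwa [ofCoprod_toCoprod, ofCoprod_toCoprod, SemidirectProduct.inl_inj] at this

theorem toCoprod_translate (g : G) (n : FreePower G H) :
    toCoprod (translate g n) = Coprod.inl g * toCoprod n * (Coprod.inl g)⁻¹ := by
  refine DFunLike.congr_fun (f := toCoprod.comp (translate g))
    (g := (MulAut.conj (Coprod.inl g)).toMonoidHom.comp toCoprod)
    (CoprodI.ext_hom _ _ fun a => MonoidHom.ext fun h => ?_) n
  change toCoprod (translate g (of a h)) = Coprod.inl g * toCoprod (of a h) * (Coprod.inl g)⁻¹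
  simp [mul_assoc]

end FreePower

open FreePower

variable [Group G]

variable (H) in
/-- The subgroup of `G ∗ H` generated by the conjugates of `H` by the elements of `A`. -/
noncomputable def conjSubgroup (A : Set G) : Subgroup (Coprod G H) :=
  -- The free product of the factors indexed by `A` is taken as the fixed subgroup of a retraction,
  -- so that membership is an equation.
  ((retract A).eqLocus (MonoidHom.id (FreePower G H))).map toCoprod

theorem toCoprod_mem_conjSubgroup {A : Set G} {n : FreePower G H} :
    toCoprod n ∈ conjSubgroup H A ↔ retract A n = n :=
  toCoprod_injective.mem_set_image (s := {n | retract A n = n})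

theorem conjSubgroup_infinite [Nontrivial H] {A : Set G} (hA : A.Infinite) :
    (conjSubgroup H A : Set (Coprod G H)).Infinite := by
  obtain ⟨h, hh⟩ := exists_ne (1 : H)
  refine (hA.image (f := fun a => toCoprod (of a h))
    (toCoprod_injective.comp (of_left_injective hh)).injOn).mono ?_
  rintro _ ⟨a, ha, rfl⟩
  exact toCoprod_mem_conjSubgroup.2 (by simp [ha])

theorem conj_inl_mem_conjSubgroup_iff {B : Set G} {g : G} {γ : Coprod G H} :
    Coprod.inl g * γ * (Coprod.inl g)⁻¹ ∈ conjSubgroup H B ↔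
      γ ∈ conjSubgroup H {a | g * a ∈ B} := by
  constructor
  · rintro ⟨m, hm, hmγ⟩
    obtain ⟨n, rfl⟩ := (translateAut G H g).surjective m
    rw [translateAut_apply] at hm hmγ
    refine ⟨n, (retract_translate_eq_iff g B n).1 hm, ?_⟩
    rw [toCoprod_translate] at hmγ
    simpa using hmγ
  · rintro ⟨n, hn, rfl⟩
    rw [← toCoprod_translate, toCoprod_mem_conjSubgroup]
    exact (retract_translate_eq_iff g B n).2 hn

theorem mem_conjSubgroup_inter {A B : Set G} {γ : Coprod G H} :
    γ ∈ conjSubgroup H (A ∩ B) ↔ γ ∈ conjSubgroup H A ∧ γ ∈ conjSubgroup H B := by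
  constructor
  · rintro ⟨n, hn, rfl⟩
    rw [toCoprod_mem_conjSubgroup, toCoprod_mem_conjSubgroup]
    exact (retract_inter_eq_iff A B n).1 hn
  · rintro ⟨⟨n, hn, rfl⟩, h⟩
    exact ⟨n, (retract_inter_eq_iff A B n).2 ⟨hn, toCoprod_mem_conjSubgroup.1 h⟩, rfl⟩

/-- If a conjugate of `conjSubgroup H B` contains `conjSubgroup H A` then a translate of `B`
contains `A`. -/
theorem exists_translate_of_conj_mem_conjSubgroup [Nontrivial H] {A B : Set G} (γ : Coprod G H)
    (hγ : ∀ s ∈ conjSubgroup H A, γ⁻¹ * s * γ ∈ conjSubgroup H B) :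
    ∃ g : G, ∀ a ∈ A, g * a ∈ B := by
  obtain ⟨h, hh⟩ := exists_ne (1 : H)
  refine ⟨(ofCoprod γ).right⁻¹, fun a ha => ?_⟩
  by_contra hcon
  obtain ⟨m, hm, hmγ⟩ := hγ (toCoprod (of a h)) (toCoprod_mem_conjSubgroup.2 (by simp [ha]))
  have h1 : ofCoprod γ * SemidirectProduct.inl m =
      SemidirectProduct.inl (of a h) * ofCoprod γ := by
    rw [← ofCoprod_toCoprod, ← ofCoprod_toCoprod, ← map_mul, ← map_mul, hmγ]
    congr 1
    group
  -- Compare the coordinates at `a`. On the left `m` contributes through the factor of index `g *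
  -- a`, where `g` is the chosen translation; this index is outside `B`, so the contribution is
  -- trivial and `h = 1`.
  have h2 := congrArg (fun p => proj a p.left) h1
  simp only [SemidirectProduct.mul_left, SemidirectProduct.left_inl, SemidirectProduct.right_inl,
    map_mul, map_one, MulAut.one_apply, translateAut_apply, proj_translate] at h2
  have hm' : retract B m = m := hm
  rw [← hm', proj_retract hcon] at h2
  simp at h2
  exact hh h2

instance Monoid.Coprod.instCountable [Countable G] [Countable H] : Countable (Coprod G H) :=
  have : Countable (FreeMonoid (G ⊕ H)) := inferInstanceAs (Countable (List (G ⊕ H)))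
  Coprod.mk_surjective.countable

theorem measurableSet_mem_conjSubgroup [Countable G] [Countable H] {X : Type*} [MeasurableSpace X]
    {A : X → Set G} (hA : ∀ a, MeasurableSet {x | a ∈ A x}) (γ : Coprod G H) :
    MeasurableSet {x | γ ∈ conjSubgroup H (A x)} := by
  have : Countable (FreePower G H) := toCoprod_injective.countable
  -- The target `m` is arbitrary so that the induction passes through products: the value of a
  -- product splits over countably many factorizations of `m`.
  have key : ∀ n m : FreePower G H, MeasurableSet {x | retract (A x) n = m} := by
    intro n
    induction n using CoprodI.induction_on with
    | one => simp
    | of a h =>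
      intro m
      have : {x | retract (A x) (of a h) = m} =
          ({x | a ∈ A x} ∩ {_x | of a h = m}) ∪ ({x | a ∈ A x}ᶜ ∩ {_x | 1 = m}) := by
        ext x
        by_cases hx : a ∈ A x <;> simp [hx]
      rw [this]
      exact ((hA a).inter (.const _)).union ((hA a).compl.inter (.const _))
    | mul n n' ih ih' =>
      intro m
      have : {x | retract (A x) (n * n') = m} =
          ⋃ p : {p : FreePower G H × FreePower G H // p.1 * p.2 = m},
            {x | retract (A x) n = p.1.1} ∩ {x | retract (A x) n' = p.1.2} := by
        ext x
        simp
      rw [this]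
      exact .iUnion fun p => (ih _).inter (ih' _)
  by_cases h : ∃ n, toCoprod n = γ
  · obtain ⟨n, rfl⟩ := h
    simpa only [toCoprod_mem_conjSubgroup] using key n n
  · convert MeasurableSet.empty
    exact eq_empty_of_forall_notMem fun x ⟨n, _, hn⟩ => h ⟨n, hn⟩

end

end FreePower

/-! ### The Borel reduction -/

section Reduction

open Set Monoid

/-- Every countable Borel quasi-order is enumerated by countably many Borel maps. -/
theorem IsCountableBorelQuasiOrder.exists_measurable_enumeration {X : Type*} [MeasurableSpace X]
    {Q : X → X → Prop} (hQ : IsCountableBorelQuasiOrder Q) :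
    ∃ F : ℕ → X → X, (∀ n, Measurable (F n)) ∧ ∀ x y, Q y x ↔ ∃ n, F n x = y := by
  have := hQ.standardBorel
  exact exists_measurable_enumeration_of_countable_sections (P := fun x y => Q y x)
    (measurable_swap hQ.borel) hQ.countable_predecessors measurable_id hQ.refl

theorem exists_borelReduction_conjIntersection {G H : Type*} [Group G] [Countable G] [Group H]
    [Countable H] [Nontrivial H] {ι : FreeGroup OrbitLetter →* G} (hι : Function.Injective ι)
    {X : Type*} [MeasurableSpace X] {Q : X → X → Prop} (hQ : IsCountableBorelQuasiOrder Q) :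
    ∃ f : X → Subgroup (Coprod G H), Measurable f ∧ (∀ x, (f x : Set (Coprod G H)).Infinite) ∧
      ∀ x y, Q x y ↔ ConjIntersection (f x) (f y) := by
  have := hQ.standardBorel
  obtain ⟨F, hF, hFQ⟩ := hQ.exists_measurable_enumeration
  obtain ⟨β, hβ, hβi⟩ := MeasurableSpace.measurable_injection_nat_bool_of_countablySeparated X
  let A : X → Set G := fun x => ι '' orbitCode F β x
  have hA : ∀ a, MeasurableSet {x | a ∈ A x} := by
    intro a
    by_cases h : ∃ g, ι g = a
    · obtain ⟨g, rfl⟩ := h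
      simpa only [A, hι.mem_set_image] using measurableSet_mem_orbitCode hF hβ g
    · convert MeasurableSet.empty
      exact eq_empty_of_forall_notMem fun x ⟨g, _, hg⟩ => h ⟨g, hg⟩
  refine ⟨fun x => conjSubgroup H (A x),
    measurable_subgroup_iff.2 (measurableSet_mem_conjSubgroup hA),
    fun x => conjSubgroup_infinite ((orbitCode_infinite x).image hι.injOn), fun y x => ⟨?_, ?_⟩⟩
  · intro hyx
    obtain ⟨n, rfl⟩ := (hFQ x y).1 hyx
    let g : Bool → G := fun b => ι (FreeGroup.of (.inl (n, b)))
    have hAn : A (F n x) = {a | g false * a ∈ A x} ∩ {a | g true * a ∈ A x} := by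
      ext a
      constructor
      · rintro ⟨u, hu, rfl⟩
        rw [mem_orbitCode_map_iff] at hu
        exact ⟨⟨_, hu false, map_mul ι _ _⟩, ⟨_, hu true, map_mul ι _ _⟩⟩
      · rintro ⟨⟨u, hu, hua⟩, ⟨v, hv, hva⟩⟩
        have ha : a = ι ((FreeGroup.of (.inl (n, false)))⁻¹ * u) := by
          rw [map_mul, map_inv, hua, inv_mul_cancel_left]
        subst ha
        refine ⟨_, (mem_orbitCode_map_iff n x _).2 (Bool.rec ?_ ?_), rfl⟩
        · rwa [mul_inv_cancel_left]
        · rwa [← hι (hva.trans (map_mul ι _ _).symm)]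
    -- The set of `a` with `g b * a ∈ A x` is the translate of `A x` by `(g b)⁻¹`, hence the
    -- inverses.
    refine .of_fintype (fun b : Bool => (Coprod.inl (g b))⁻¹) fun γ => ?_
    dsimp only
    rw [hAn, mem_conjSubgroup_inter, Bool.forall_bool, inv_inv, inv_inv,
      conj_inl_mem_conjSubgroup_iff, conj_inl_mem_conjSubgroup_iff]
  · intro h
    obtain ⟨⟨m, k⟩, hk⟩ := conjIntersection_iff.1 h
    obtain ⟨g, hg⟩ := exists_translate_of_conj_mem_conjSubgroup (k 0) fun s hs => (hk s).1 hs 0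
    -- One point of the code suffices to see that `g` lies in the range of `ι`, so the translation
    -- takes place inside the free group.
    obtain ⟨u, hu⟩ := (orbitCode_infinite (F := F) (β := β) y).nonempty
    obtain ⟨v, -, hv⟩ := hg _ ⟨u, hu, rfl⟩
    have hgv : g = ι (v * u⁻¹) := by rw [map_mul, hv, map_inv, mul_inv_cancel_right]
    refine rel_of_orbitCode_subset hQ.refl hQ.trans (fun n x => (hFQ x _).2 ⟨n, rfl⟩) hβi
      (v * u⁻¹) fun w hw => ?_
    have := hg _ ⟨w, hw, rfl⟩
    rwa [hgv, ← map_mul, hι.mem_set_image] at this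

theorem exists_injective_freeGroup_orbitLetter {G : Type*} [Group G]
    (hG : ∃ F : Subgroup G, IsFreeGroup F ∧ ∃ x y : F, x * y ≠ y * x) :
    ∃ ι : FreeGroup OrbitLetter →* G, Function.Injective ι := by
  obtain ⟨F, hF, hxy⟩ := hG
  obtain ⟨f, hf⟩ := FreeGroup.exists_injective_of_noncomm hxy
  obtain ⟨e, he⟩ := exists_injective_nat OrbitLetter
  exact ⟨F.subtype.comp (f.comp (FreeGroup.map fun a => (e a : ℤ))),
    F.subtype_injective.comp (hf.comp
      (FreeGroup.map_injective (Nat.cast_injective.comp he)))⟩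

end Reduction

theorem mainTheorem9 (G : Type u) [Group G] [Countable G]
    (hG : ∃ F : Subgroup G, IsFreeGroup F ∧ ∃ x y : F, x * y ≠ y * x)
    (H : Type v) [Group H] [IsCyclic H] [Nontrivial H] :
    IsUniversalCountableBorelQuasiOrder.{w}
        (ConjIntersectionInfinite (G := Monoid.Coprod G H)) ∧
      IsUniversalCountableBorelQuasiOrder.{w}
        (ConjIntersection (G := Monoid.Coprod G H)) := by
  obtain ⟨ι, hι⟩ := exists_injective_freeGroup_orbitLetter hG
  have : Countable H := by
    obtain ⟨h, hh⟩ := IsCyclic.exists_zpow_surjective (G := H)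
    exact hh.countable
  refine ⟨⟨isCountableBorelQuasiOrder_conjIntersectionInfinite, fun X _ Q hQ => ?_⟩,
    ⟨isCountableBorelQuasiOrder_conjIntersection, fun X _ Q hQ => ?_⟩⟩
  · obtain ⟨f, hf, hinf, hred⟩ := exists_borelReduction_conjIntersection (H := H) hι hQ
    exact ⟨fun x => ⟨f x, hinf x⟩, hf.subtype_mk, hred⟩
  · obtain ⟨f, hf, -, hred⟩ := exists_borelReduction_conjIntersection (H := H) hι hQ
    exact ⟨f, hf, hred⟩
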